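/- Let $(r_n)_{n\ge 0} = 1, 2, 6, 22, 90, \dots$ be the large Schröder numbers and $(s_n)_{n\ge 0} = 1, 1, 3, 11, 45, \dots$ the little Schröder numbers (so $r_0=s_0=1$ and $r_n=2s_n$ for $n\ge 1$). For $0\le k\le n$ let $$B_{n,k}(z_1,z_2,\dots)=\sum_{\alpha}\frac{n!}{\alpha_1!\,\alpha_2!\cdots}\left(\frac{z_1}{1!}\right)^{\alpha_1}\left(\frac{z_2}{2!}\right)^{\alpha_2}\cdots$$ be the $(n,k)$-th exponential partial Bell polynomial, where the sum is over all $\alpha\in\mathbb{N}_0^{\,n-k+1}$ with $\alpha_1+\alpha_2+\cdots=k$ and $\alpha_1+2\alpha_2+3\alpha_3+\cdots=n$. Then, for all integers $1\le k<n$, $$\begin{aligned} B_{n,k}(1!\,r_0,\,2!\,r_1,\,3!\,r_2,\dots) &=\sum_{\ell=0}^{k}(-1)^{\ell}\,2^{k-\ell}\binom{n}{\ell}\,B_{n-\ell,\,k-\ell}(1!\,s_0,\,2!\,s_1,\,3!\,s_2,\dots)\\ &=\frac{n!}{(k-1)!}\sum_{\ell=0}^{k}\sum_{j=1}^{n-k}\frac{(-1)^{\ell}\,2^{k-\ell}}{j}\binom{k-1}{\ell}\binom{n-k-1}{j-1}\binom{n-\ell+j-1}{j-1}.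 \end{aligned}$$ -/

import Mathlib

open scoped Nat

/-- The set `π(n,k)` of multi-indices `α = (α₁, …, α_{n-k+1})` of natural numbers with
`α₁ + α₂ + ⋯ = k` and `α₁ + 2 α₂ + 3 α₃ + ⋯ = n`. The entry `α_{i+1}` is `α i` for
`i : Fin (n - k + 1)`. (Bounding the entries by `k` only serves to have a finite set,
see `mem_bellIndex`.) -/
def bellIndex (n k : ℕ) : Finset (Fin (n - k + 1) → ℕ) :=
  (Fintype.piFinset fun _ => Finset.range (k + 1)).filter fun α =>
    ∑ i, α i = k ∧ ∑ i : Fin (n - k + 1), ((i : ℕ) + 1) * α i = n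

theorem mem_bellIndex (n k : ℕ) (α : Fin (n - k + 1) → ℕ) :
    α ∈ bellIndex n k ↔ ∑ i, α i = k ∧ ∑ i : Fin (n - k + 1), ((i : ℕ) + 1) * α i = n := by
  simp only [bellIndex, Finset.mem_filter, Fintype.mem_piFinset, Finset.mem_range,
    and_iff_right_iff_imp]
  rintro ⟨h, -⟩ i
  have := Finset.single_le_sum (f := α) (fun j _ => Nat.zero_le _) (Finset.mem_univ i)
  omega

/-- The value `B_{n,k}(z₁, …, z_{n-k+1})` of the `(n,k)`-th exponential partial Bell polynomial,
for `0 ≤ k ≤ n`. The sequence of arguments is indexed from `0`, i.e. `z i` is the argument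
`z_{i+1}`. -/
def partialBell (n k : ℕ) (z : ℕ → ℚ) : ℚ :=
  ∑ α ∈ bellIndex n k,
    (n ! : ℚ) / (∏ i, (α i)! : ℕ) * ∏ i : Fin (n - k + 1), (z i / (((i : ℕ) + 1)! : ℚ)) ^ α i

/-- The little Schröder numbers `s₀, s₁, s₂, … = 1, 1, 3, 11, 45, 197, …`. Mathlib's
`Nat.smallSchroder` is the same sequence with an additional leading `1`, namely
`1, 1, 1, 3, 11, 45, …`, so the index is shifted by one. -/
def littleSchroder (n : ℕ) : ℕ := Nat.smallSchroder (n + 1)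

/-!
The Bell polynomial `B_{n,k}(z₁, z₂, …)` is `n! / k!` times the coefficient of `X ^ (n - k)` in the
`k`-th power of `Z = ∑ z_{i+1} X ^ i / (i + 1)!`. Replacing `z₁` by `z₁ + c` replaces `Z` by
`Z + c`, so the binomial theorem expands the new Bell polynomials in the old ones; since
`r = 2 s - δ₀`, this is the first identity.

For the second one, the generating function `S` of the little Schröder numbers solves
`S = φ (X S)` with `φ = (1 - X) / (1 - 2 X)`. Lagrange inversion turns coefficients of powers of `S`
into coefficients of powers of `φ`; these are explicit since `φ = 1 / (1 - X / (1 - X))`.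
-/

section Series

open PowerSeries
open Finset hiding mk

section CommSemiring

variable {R : Type*} [CommSemiring R]

theorem coeff_pow_eq_coeff_trunc_pow (f : R⟦X⟧) (m k : ℕ) :
    coeff m (f ^ k) = coeff m ((trunc (m + 1) f : R⟦X⟧) ^ k) := by
  rw [← coeff_coe_trunc_of_lt m.lt_succ_self, ← trunc_trunc_pow,
    coeff_coe_trunc_of_lt m.lt_succ_self]

theorem coe_trunc_succ_eq_sum_fin (f : R⟦X⟧) (m : ℕ) :
    (trunc (m + 1) f : R⟦X⟧) = ∑ i : Fin (m + 1), C (coeff (i : ℕ) f) * X ^ (i : ℕ) := by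
  ext i
  rw [Fin.sum_univ_eq_sum_range (fun i => C (coeff i f) * X ^ i), Polynomial.coeff_coe,
    coeff_trunc, map_sum]
  simp [coeff_X_pow]

theorem prod_C_mul_X_pow_pow {ι : Type*} (s : Finset ι) (a : ι → R) (d α : ι → ℕ) :
    ∏ i ∈ s, (C (a i) * X ^ d i) ^ α i = C (∏ i ∈ s, a i ^ α i) * X ^ ∑ i ∈ s, d i * α i := by
  simp_rw [mul_pow, prod_mul_distrib, ← pow_mul, prod_pow_eq_pow_sum, map_prod, map_pow]

theorem coeff_pow_eq_sum_multinomial (f : R⟦X⟧) (m k : ℕ) :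
    coeff m (f ^ k) =
      ∑ α ∈ piAntidiag univ k with ∑ i : Fin (m + 1), (i : ℕ) * α i = m,
        (Nat.multinomial univ α : R) * ∏ i : Fin (m + 1), coeff (i : ℕ) f ^ α i := by
  rw [coeff_pow_eq_coeff_trunc_pow, coe_trunc_succ_eq_sum_fin, sum_pow_eq_sum_piAntidiag, map_sum,
    sum_filter]
  refine sum_congr rfl fun α _ => ?_
  rw [prod_C_mul_X_pow_pow, ← map_natCast C, ← mul_assoc, ← map_mul, coeff_C_mul, coeff_X_pow,
    mul_ite, mul_one, mul_zero]
  simp only [eq_comm]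

theorem coeff_X_mul_derivative (f : R⟦X⟧) (m : ℕ) :
    coeff m (X * d⁄dX R f) = m * coeff m f := by
  cases m with
  | zero => simp
  | succ m => rw [coeff_succ_X_mul, coeff_derivative, mul_comm, Nat.cast_succ]

theorem succ_mul_sum_antidiagonal_mul_coeff_pow (f : R⟦X⟧) (m N : ℕ) :
    (N + 1 : R) * ∑ x ∈ antidiagonal m, x.1 * coeff x.1 f * coeff x.2 (f ^ N) =
      m * coeff m (f ^ (N + 1)) := by
  simp_rw [← coeff_X_mul_derivative, ← coeff_mul]
  rw [derivative_pow, Nat.add_sub_cancel, ← Nat.cast_succ, ← map_natCast C, ← coeff_C_mul]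
  congr 1
  ring

end CommSemiring

section CommRing

variable {R : Type*} [CommRing R]

theorem coeff_subst_eq_sum_range {a : R⟦X⟧} (ha : constantCoeff a = 0) (f : R⟦X⟧) {m N : ℕ}
    (hmN : m < N) :
    coeff m (f.subst a) = ∑ i ∈ range N, coeff i f * coeff m (a ^ i) := by
  rw [coeff_subst' (.of_constantCoeff_zero' ha)]
  refine finsum_eq_sum_of_support_subset _ fun i hi => ?_
  contrapose! hi
  have hmi : m < i := hmN.trans_le (by simpa using hi)
  have hdvd : X ^ i ∣ a ^ i := pow_dvd_pow_of_dvd (X_dvd_iff.2 ha) i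
  simp [X_pow_dvd_iff.1 hdvd m hmi]

theorem coeff_mul_subst {a : R⟦X⟧} (ha : constantCoeff a = 0) (f g : R⟦X⟧) (m : ℕ) :
    coeff m (g * f.subst a) = ∑ i ∈ range (m + 1), coeff i f * coeff m (g * a ^ i) := by
  simp_rw [coeff_mul, mul_sum]
  rw [sum_comm]
  refine sum_congr rfl fun x hx => ?_
  rw [coeff_subst_eq_sum_range ha f (Nat.antidiagonal.snd_lt hx), mul_sum]
  exact sum_congr rfl fun i _ => by ring

theorem coeff_mul_subst_X_mul (f g h : R⟦X⟧) (m : ℕ) :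
    coeff m (g * f.subst (X * h)) =
      ∑ x ∈ antidiagonal m, coeff x.1 f * coeff x.2 (g * h ^ x.1) := by
  rw [coeff_mul_subst (by simp), Nat.sum_antidiagonal_eq_sum_range_succ_mk]
  refine sum_congr rfl fun i hi => ?_
  rw [mul_pow, mul_left_comm, coeff_X_pow_mul', if_pos (mem_range_succ_iff.1 hi)]

section Lagrange

variable {f g : R⟦X⟧}

theorem coeff_pow_succ_of_eq_subst (hf : f = g.subst (X * f)) (m p : ℕ) :
    coeff m (f ^ (p + 1)) = ∑ x ∈ antidiagonal m, coeff x.1 g * coeff x.2 (f ^ (p + x.1)) := by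
  have h : f ^ (p + 1) = f ^ p * g.subst (X * f) := by rw [← hf, pow_succ]
  simp_rw [h, coeff_mul_subst_X_mul, pow_add]

theorem lagrange_inversion [IsAddTorsionFree R] (hf : f = g.subst (X * f)) (m p : ℕ) :
    (m + p : R) * coeff m (f ^ p) = p * coeff m (g ^ (m + p)) := by
  induction m using Nat.strong_induction_on generalizing p with
  | _ m ihm =>
  induction p with
  | zero =>
    rcases eq_or_ne m 0 with rfl | hm
    · simp
    · simp [coeff_one, hm]
  | succ p ihp =>
    rcases Nat.eq_zero_or_pos (m + p) with h0 | hpos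
    · obtain ⟨rfl, rfl⟩ : m = 0 ∧ p = 0 := by omega
      simpa using coeff_pow_succ_of_eq_subst hf 0 0
    -- By induction each term of the recursion is a coefficient of `g ^ (m + p)`, which makes the
    -- whole sum a coefficient of `(p * g + X * d⁄dX R g) * g ^ (m + p)`.
    have hterm : ∀ x ∈ antidiagonal m, (m + p : R) * coeff x.2 (f ^ (p + x.1)) =
        (p + x.1) * coeff x.2 (g ^ (m + p)) := by
      rintro ⟨i, j⟩ hx
      obtain rfl : i + j = m := mem_antidiagonal.1 hx
      rcases Nat.eq_zero_or_pos i with rfl | hi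
      · simpa using ihp
      · have := ihm j (by omega) (p + i)
        rw [show j + (p + i) = i + j + p by ring] at this
        push_cast at this ⊢
        linear_combination this
    have hsum : (m + p : R) * coeff m (f ^ (p + 1)) = p * coeff m (g ^ (m + p + 1)) +
        ∑ x ∈ antidiagonal m, x.1 * coeff x.1 g * coeff x.2 (g ^ (m + p)) := by
      rw [coeff_pow_succ_of_eq_subst hf, pow_succ', coeff_mul, mul_sum, mul_sum,
        ← sum_add_distrib]
      refine sum_congr rfl fun x hx => ?_
      linear_combination coeff x.1 g * hterm x hx
    have hderiv := succ_mul_sum_antidiagonal_mul_coeff_pow g m (m + p)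
    refine nsmul_right_injective hpos.ne' ?_
    simp only [nsmul_eq_mul, ← add_assoc]
    push_cast at hderiv ⊢
    linear_combination (m + p + 1 : R) * hsum + hderiv

end Lagrange

theorem subst_mk_choose_mul_one_sub_pow {a : R⟦X⟧} (ha : HasSubst a) (d : ℕ) :
    (mk fun j => ((d + j).choose d : R)).subst a * (1 - a) ^ (d + 1) = 1 := by
  have h := congrArg (substAlgHom (R := R) ha) (mk_add_choose_mul_one_sub_pow_eq_one R d)
  rwa [map_mul, map_pow, map_sub, map_one, substAlgHom_X, coe_substAlgHom] at h

theorem coeff_succ_X_mul_mk_one_pow_succ (m j : ℕ) :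
    coeff (m + 1) ((X * mk 1 : R⟦X⟧) ^ (j + 1)) = m.choose j := by
  rw [mul_pow, mk_one_pow_eq_mk_choose_add, coeff_X_pow_mul', coeff_mk]
  split_ifs with h
  · congr 2; omega
  · rw [Nat.choose_eq_zero_of_lt (by omega), Nat.cast_zero]

theorem coeff_succ_pow_succ_of_mul_eq_one {f : R⟦X⟧} (hf : f * (1 - X * mk 1) = 1) (d m : ℕ) :
    coeff (m + 1) (f ^ (d + 1)) =
      ∑ j ∈ range (m + 1), ((d + (j + 1)).choose d : R) * (m.choose j : R) := by
  have hconst : constantCoeff (X * mk 1 : R⟦X⟧) = 0 := by simp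
  have hpow : f ^ (d + 1) = (mk fun j => ((d + j).choose d : R)).subst (X * mk 1 : R⟦X⟧) := by
    refine left_inv_eq_right_inv (a := (1 - X * mk 1) ^ (d + 1)) ?_ ?_
    · rw [← mul_pow, hf, one_pow]
    · rw [mul_comm, subst_mk_choose_mul_one_sub_pow (.of_constantCoeff_zero' hconst)]
  rw [hpow, coeff_subst_eq_sum_range hconst _ (m + 1).lt_succ_self, sum_range_succ']
  simp [coeff_succ_X_mul_mk_one_pow_succ, coeff_one]

end CommRing

end Series

section Schroder

open PowerSeries
open Finset hiding mk

/-- The generating function `S = 1 + X + 3 X ^ 2 + 11 X ^ 3 + ⋯` of the little Schröder numbers. -/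
noncomputable def littleSchroderSeries : ℚ⟦X⟧ := mk fun i => (littleSchroder i : ℚ)

/-- The power series `φ = (1 - X) / (1 - 2 X)`, to which Lagrange inversion applies because the
series `S` above satisfies `S = φ (X S)`. -/
noncomputable def schroderKernel : ℚ⟦X⟧ := (1 - X) * (1 - 2 * X)⁻¹

theorem largeSchroder_eq_two_mul_littleSchroder_sub (i : ℕ) :
    (Nat.largeSchroder i : ℚ) = 2 * littleSchroder i - if i = 0 then 1 else 0 := by
  rcases eq_or_ne i 0 with rfl | hi
  · norm_num [littleSchroder]
  · rw [littleSchroder, ← Nat.two_mul_smallSchroder_succ hi, if_neg hi]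
    push_cast
    ring

theorem map_largeSchroderSeries_eq :
    map (Nat.castRingHom ℚ) largeSchroderSeries = 2 * littleSchroderSeries - 1 := by
  ext i
  rw [map_sub, ← map_ofNat (C (R := ℚ)) 2, coeff_C_mul, coeff_one, littleSchroderSeries, coeff_mk,
    ← largeSchroder_eq_two_mul_littleSchroder_sub]
  simp

theorem littleSchroderSeries_eq_one_add :
    littleSchroderSeries = 1 + X * littleSchroderSeries * (2 * littleSchroderSeries - 1) := by
  have h := congrArg (map (Nat.castRingHom ℚ))
    largeSchroderSeries_eq_one_add_X_mul_largeSchroderSeries_add_X_mul_largeSchroderSeries_sq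
  simp only [map_add, map_mul, map_pow, map_X, map_one, map_largeSchroderSeries_eq] at h
  have h2 : (2 : ℚ⟦X⟧) ≠ 0 := by
    rw [← map_ofNat (C (R := ℚ)) 2]
    exact (map_ne_zero_iff C C_injective).2 two_ne_zero
  refine mul_left_cancel₀ h2 ?_
  linear_combination h

theorem schroderKernel_mul_one_sub_two_mul_X : schroderKernel * (1 - 2 * X) = 1 - X := by
  rw [schroderKernel, mul_assoc, PowerSeries.inv_mul_cancel _ (by simp), mul_one]

theorem schroderKernel_mul_one_sub_X_mul_mk_one : schroderKernel * (1 - X * mk 1) = 1 := by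
  linear_combination mk 1 * schroderKernel_mul_one_sub_two_mul_X +
    (1 - schroderKernel) * mk_one_mul_one_sub_eq_one ℚ

theorem littleSchroderSeries_eq_subst :
    littleSchroderSeries = schroderKernel.subst (X * littleSchroderSeries) := by
  have ha : HasSubst (X * littleSchroderSeries) := .of_constantCoeff_zero' (by simp)
  have h := congrArg (substAlgHom (R := ℚ) ha) schroderKernel_mul_one_sub_two_mul_X
  simp only [map_mul, map_sub, map_one, map_ofNat, substAlgHom_X] at h
  rw [coe_substAlgHom] at h
  have hne : 1 - 2 * (X * littleSchroderSeries) ≠ 0 := fun h0 => by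
    simpa using congrArg constantCoeff h0
  refine mul_right_cancel₀ hne ?_
  linear_combination littleSchroderSeries_eq_one_add - h

theorem choose_add_succ_eq (N j : ℕ) :
    ((N + (j + 1)).choose N : ℚ) = (N + 1) * (1 / (j + 1) * (N + 1 + j).choose j) := by
  have h := Nat.choose_succ_right_eq (N + 1 + j) j
  rw [Nat.choose_symm_add, show N + (j + 1) = N + 1 + j by ring]
  rw [Nat.add_sub_cancel] at h
  have hmul : ((N + 1 + j).choose (j + 1) : ℚ) * (j + 1) = (N + 1 + j).choose j * (N + 1) := by
    exact_mod_cast h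
  field_simp
  linear_combination hmul

theorem coeff_littleSchroderSeries_pow {m : ℕ} (hm : m ≠ 0) (p : ℕ) :
    coeff m (littleSchroderSeries ^ p) = p * ∑ j ∈ Icc 1 m,
      (1 / j : ℚ) * ((m - 1).choose (j - 1) : ℚ) * ((m + p + j - 1).choose (j - 1) : ℚ) := by
  obtain ⟨m, rfl⟩ := Nat.exists_eq_add_one_of_ne_zero hm
  have h := lagrange_inversion littleSchroderSeries_eq_subst (m + 1) p
  rw [show m + 1 + p = m + p + 1 by ring,
    coeff_succ_pow_succ_of_mul_eq_one schroderKernel_mul_one_sub_X_mul_mk_one] at h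
  have h0 : (((m + 1 : ℕ) : ℚ) + p) ≠ 0 := by positivity
  refine mul_left_cancel₀ h0 (h.trans ?_)
  rw [mul_left_comm]
  congr 1
  rw [mul_sum, ← Ico_add_one_right_eq_Icc, sum_Ico_eq_sum_range]
  refine sum_congr rfl fun j _ => ?_
  rw [choose_add_succ_eq, show m + 1 + p + (1 + j) - 1 = m + p + 1 + j by omega, add_comm 1 j]
  simp only [Nat.add_sub_cancel]
  push_cast
  ring

end Schroder

section Bell

open PowerSeries
open Finset hiding mk

/-- The power series `∑ z_{i+1} X ^ i / (i + 1)!`, which is the exponential generating function of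
`z₁, z₂, …` divided by `X`; its powers have the partial Bell polynomials as coefficients. -/
noncomputable def bellSeries (z : ℕ → ℚ) : ℚ⟦X⟧ := mk fun i => z i / ((i + 1)! : ℚ)

theorem bellSeries_factorial_mul (a : ℕ → ℚ) :
    bellSeries (fun i => ((i + 1)! : ℚ) * a i) = mk a := by
  ext i
  rw [bellSeries, coeff_mk, coeff_mk, mul_div_cancel_left₀ _ (by positivity)]

theorem bellSeries_add_single_zero (z : ℕ → ℚ) (c : ℚ) :
    bellSeries (z + Pi.single 0 c) = bellSeries z + C c := by
  ext i
  rcases eq_or_ne i 0 with rfl | hi <;> simp [bellSeries, coeff_C, *]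

theorem bellIndex_eq_filter_piAntidiag {n k : ℕ} (hkn : k ≤ n) :
    bellIndex n k =
      (piAntidiag univ k).filter fun α => ∑ i : Fin (n - k + 1), (i : ℕ) * α i = n - k := by
  ext α
  simp only [mem_bellIndex, mem_filter, mem_piAntidiag, add_mul, one_mul, sum_add_distrib,
    mem_univ, implies_true, and_true]
  exact and_congr_right fun h => by omega

theorem partialBell_eq_coeff_bellSeries_pow {n k : ℕ} (hkn : k ≤ n) (z : ℕ → ℚ) :
    partialBell n k z = (n ! : ℚ) / (k ! : ℚ) * coeff (n - k) (bellSeries z ^ k) := by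
  rw [coeff_pow_eq_sum_multinomial, ← bellIndex_eq_filter_piAntidiag hkn, partialBell, mul_sum]
  refine sum_congr rfl fun α hα => ?_
  have hmul : ((∏ i, (α i)! : ℕ) : ℚ) * Nat.multinomial univ α = (k ! : ℚ) := by
    have hsum : ∑ i, α i = k := ((mem_bellIndex n k α).1 hα).1
    exact_mod_cast hsum ▸ Nat.multinomial_spec univ α
  have hprod : ((∏ i, (α i)! : ℕ) : ℚ) ≠ 0 := by
    exact_mod_cast (prod_pos fun i _ => Nat.factorial_pos (α i)).ne'
  have hk : (k ! : ℚ) ≠ 0 := by positivity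
  simp only [bellSeries, coeff_mk]
  rw [← mul_assoc]
  congr 1
  field_simp
  exact hmul.symm

theorem partialBell_const_mul (n k : ℕ) (c : ℚ) (z : ℕ → ℚ) :
    partialBell n k (fun i => c * z i) = c ^ k * partialBell n k z := by
  rw [partialBell, partialBell, mul_sum]
  refine sum_congr rfl fun α hα => ?_
  simp_rw [mul_div_assoc, mul_pow]
  rw [prod_mul_distrib, prod_pow_eq_pow_sum, ((mem_bellIndex n k α).1 hα).1]
  ring

theorem partialBell_add_single_zero {n k : ℕ} (hkn : k ≤ n) (z : ℕ → ℚ) (c : ℚ) :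
    partialBell n k (z + Pi.single 0 c) =
      ∑ l ∈ range (k + 1), c ^ l * n.choose l * partialBell (n - l) (k - l) z := by
  rw [partialBell_eq_coeff_bellSeries_pow hkn, bellSeries_add_single_zero, add_comm, add_pow,
    map_sum, mul_sum]
  refine sum_congr rfl fun l hl => ?_
  have hlk : l ≤ k := mem_range_succ_iff.1 hl
  rw [partialBell_eq_coeff_bellSeries_pow (by omega), show n - l - (k - l) = n - k by omega,
    mul_right_comm, ← map_pow, ← map_natCast C, ← map_mul, coeff_C_mul, Nat.cast_choose ℚ hlk,
    Nat.cast_choose ℚ (hlk.trans hkn)]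
  field_simp

theorem partialBell_largeSchroder {n k : ℕ} (hkn : k ≤ n) :
    partialBell n k (fun i => ((i + 1)! : ℚ) * (Nat.largeSchroder i : ℚ)) =
      ∑ l ∈ range (k + 1), (-1 : ℚ) ^ l * 2 ^ (k - l) * (n.choose l : ℚ) *
        partialBell (n - l) (k - l) (fun i => ((i + 1)! : ℚ) * (littleSchroder i : ℚ)) := by
  have hz : (fun i => ((i + 1)! : ℚ) * (Nat.largeSchroder i : ℚ)) =
      (fun i => 2 * (((i + 1)! : ℚ) * (littleSchroder i : ℚ))) + Pi.single 0 (-1) := by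
    ext i
    rw [largeSchroder_eq_two_mul_littleSchroder_sub]
    rcases eq_or_ne i 0 with rfl | hi
    · rw [if_pos rfl, Pi.add_apply, Pi.single_eq_same, zero_add, Nat.factorial_one, Nat.cast_one]
      ring
    · rw [if_neg hi, Pi.add_apply, Pi.single_eq_of_ne hi]
      ring
  rw [hz, partialBell_add_single_zero hkn]
  refine sum_congr rfl fun l _ => ?_
  rw [partialBell_const_mul]
  ring

-- The factor `k / k !` vanishes at `k = 0`, unlike `1 / (k - 1)!` with its truncated subtraction.
theorem partialBell_littleSchroder {n k : ℕ} (hkn : k < n) :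
    partialBell n k (fun i => ((i + 1)! : ℚ) * (littleSchroder i : ℚ)) =
      (n ! : ℚ) / (k ! : ℚ) * (k * ∑ j ∈ Icc 1 (n - k),
        (1 / j : ℚ) * ((n - k - 1).choose (j - 1) : ℚ) * ((n + j - 1).choose (j - 1) : ℚ)) := by
  rw [partialBell_eq_coeff_bellSeries_pow hkn.le, bellSeries_factorial_mul,
    ← littleSchroderSeries, coeff_littleSchroderSeries_pow (by omega), Nat.sub_add_cancel hkn.le]

theorem choose_mul_factorial_div_factorial_mul {n k l : ℕ} (hk : 1 ≤ k) (hkn : k ≤ n)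
    (hlk : l ≤ k) :
    (n.choose l : ℚ) * ((n - l)! / (k - l)! * (k - l : ℕ)) =
      n ! / (k - 1)! * (k - 1).choose l := by
  rcases hlk.eq_or_lt with rfl | hlt
  · simp [Nat.choose_eq_zero_of_lt (Nat.sub_lt hk one_pos)]
  · have hfac : ((k - l)! : ℚ) = (k - l : ℕ) * (k - 1 - l)! := by
      rw [show k - 1 - l = k - l - 1 by omega]
      exact_mod_cast (Nat.mul_factorial_pred (by omega)).symm
    have hsub : ((k - l : ℕ) : ℚ) ≠ 0 := Nat.cast_ne_zero.2 (by omega)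
    rw [Nat.cast_choose ℚ (hlk.trans hkn), Nat.cast_choose ℚ (by omega), hfac]
    field_simp

end Bell

/-- The large Schröder numbers `r₀, r₁, … = 1, 2, 6, 22, …` are Mathlib's `Nat.largeSchroder`. -/
theorem mainTheorem5 (n k : ℕ) (hk : 1 ≤ k) (hkn : k < n) :
    partialBell n k (fun i => ((i + 1)! : ℚ) * (Nat.largeSchroder i : ℚ)) =
        ∑ l ∈ Finset.range (k + 1), (-1 : ℚ) ^ l * 2 ^ (k - l) * (n.choose l : ℚ) *
          partialBell (n - l) (k - l) (fun i => ((i + 1)! : ℚ) * (littleSchroder i : ℚ)) ∧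
    partialBell n k (fun i => ((i + 1)! : ℚ) * (Nat.largeSchroder i : ℚ)) =
        (n ! : ℚ) / ((k - 1)! : ℚ) *
          ∑ l ∈ Finset.range (k + 1), ∑ j ∈ Finset.Icc 1 (n - k),
            (-1 : ℚ) ^ l * 2 ^ (k - l) / (j : ℚ) *
              ((k - 1).choose l : ℚ) * ((n - k - 1).choose (j - 1) : ℚ) *
              ((n - l + j - 1).choose (j - 1) : ℚ) := by
  refine ⟨partialBell_largeSchroder hkn.le, ?_⟩
  rw [partialBell_largeSchroder hkn.le, Finset.mul_sum]
  refine Finset.sum_congr rfl fun l hl => ?_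
  have hlk : l ≤ k := Finset.mem_range_succ_iff.1 hl
  have hfac := choose_mul_factorial_div_factorial_mul hk hkn.le hlk
  rw [partialBell_littleSchroder (by omega), show n - l - (k - l) = n - k by omega]
  set A := ∑ j ∈ Finset.Icc 1 (n - k),
    (1 / j : ℚ) * ((n - k - 1).choose (j - 1) : ℚ) * ((n - l + j - 1).choose (j - 1) : ℚ) with hA
  have hsum : ∑ j ∈ Finset.Icc 1 (n - k), (-1 : ℚ) ^ l * 2 ^ (k - l) / (j : ℚ) *
      ((k - 1).choose l : ℚ) * ((n - k - 1).choose (j - 1) : ℚ) *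
      ((n - l + j - 1).choose (j - 1) : ℚ) = (-1) ^ l * 2 ^ (k - l) * (k - 1).choose l * A := by
    rw [hA, Finset.mul_sum]
    exact Finset.sum_congr rfl fun j _ => by ring
  rw [hsum]
  linear_combination (-1) ^ l * 2 ^ (k - l) * A * hfac
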